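/- Let $\lambda_2,\lambda_3,\dots$ be positive numbers with $\sum_{n\ge2}\lambda_n^{-1}<\infty$ (the death rates of a pure death process coming down from infinity), and let $X_2,X_3,\dots$ be independent random variables (the holding times), $X_i$ being exponentially distributed with $\mathbb E X_i=\lambda_i^{-1}$. For $n\ge1$ put \[T_n=\sum_{i>n}X_i,\qquad A_n=\sum_{i>n}\lambda_i^{-1},\qquad B_n=\Big(\sum_{i>n}\lambda_i^{-2}\Big)^{1/2},\qquad C_n=\Big(\sum_{i>n}\lambda_i^{-3}\Big)^{1/3};\] $T_n$ is the time at which the process started from infinity hits $n$. The series $T_n$ converges almost surely, $\mathbb E T_n=A_n$ and $\operatorname{Var}(T_n)=B_n^2$. For every $\alpha\in[0,1)$ there is a probability distribution function $F_\alpha$ on $[0,\infty)$, depending only on $\alpha$, with Laplace transform \[\int_{[0,\infty)}e^{-ux}\,dF_\alpha(x)=\prod_{i\ge0}\frac1{u\alpha^i(1-\alpha)+1},\qquad u\ge0\] (where $0^0=1$), such that the following statements hold. (i) If $\lambda_n/\lambda_{n+1}\to\alpha\in[0,1)$ as $n\to\infty$, then $\mathbb P(T_n/A_n\le x)\to F_\alpha(x)$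 as $n\to\infty$ for each fixed $x\ge0$. (ii) If $\lambda_n^{-1}=o(A_n)$ as $n\to\infty$, then $T_n/A_n\to1$ in probability. (iii) If $\sum_{i\ge1}(\lambda_{i+1}A_i)^{-2}<\infty$, then $T_n/A_n\to1$ almost surely. (iv) If $\lambda_n^{-1}=o(A_n)$ and $C_n=o(B_n)$ as $n\to\infty$, then for every real $x$ \[\mathbb P\Big(\frac{T_n-A_n}{B_n}\le x\Big)\to\Phi(x),\qquad n\to\infty,\] where $\Phi$ is the standard normal distribution function. -/

import Mathlib

open MeasureTheory ProbabilityTheory Filter Topology Asymptotics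

namespace PureDeath

/-- `X` is a sequence of holding times of a pure death process with death rates
`lam 2, lam 3, …`: the rates are positive, and the variables `X i`, for `i ≥ 2`, are independent,
`X i` being exponential with rate `lam i` (mean `1 / lam i`).
The indices `0` and `1` carry no condition. -/
structure IsHoldingTimes {Ω : Type*} [MeasurableSpace Ω] (P : Measure Ω)
    (lam : ℕ → ℝ) (X : ℕ → Ω → ℝ) : Prop where
  rate_pos : ∀ i, 2 ≤ i → 0 < lam i
  hasLaw : ∀ i, 2 ≤ i → HasLaw (X i) (expMeasure (lam i)) P
  indep : iIndepFun (fun i : {i : ℕ // 2 ≤ i} => X i) P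

/-- `T n = X (n+1) + X (n+2) + …`, the time at which the process started at infinity hits `n`. -/
noncomputable def T {Ω : Type*} (X : ℕ → Ω → ℝ) (n : ℕ) (ω : Ω) : ℝ :=
  ∑' i : ℕ, X (n + 1 + i) ω

/-- `A n = ∑_{i > n} 1 / lam i`. -/
noncomputable def A (lam : ℕ → ℝ) (n : ℕ) : ℝ :=
  ∑' i : ℕ, (lam (n + 1 + i))⁻¹

/-- `B n`, the nonnegative square root of `∑_{i > n} 1 / (lam i) ^ 2`. -/
noncomputable def B (lam : ℕ → ℝ) (n : ℕ) : ℝ :=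
  Real.sqrt (∑' i : ℕ, ((lam (n + 1 + i)) ^ 2)⁻¹)

/-- `C n`, the cube root of `∑_{i > n} 1 / (lam i) ^ 3`. -/
noncomputable def C (lam : ℕ → ℝ) (n : ℕ) : ℝ :=
  (∑' i : ℕ, ((lam (n + 1 + i)) ^ 3)⁻¹) ^ (1 / 3 : ℝ)

/-- `μ` is a probability distribution on `[0, ∞)` whose Laplace transform at every `u ≥ 0` is the
(convergent) product `∏_{i ≥ 0} 1 / (u α ^ i (1 - α) + 1)`, where `α ^ 0 = 1` also for `α = 0`. -/
structure IsLimitLaw (α : ℝ) (μ : Measure ℝ) : Prop where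
  isProbabilityMeasure : IsProbabilityMeasure μ
  nonneg : μ (Set.Iio 0) = 0
  laplace : ∀ u : ℝ, 0 ≤ u →
    HasProd (fun i : ℕ => 1 / (u * α ^ i * (1 - α) + 1))
      (∫ x in Set.Ici (0 : ℝ), Real.exp (-u * x) ∂μ)

end PureDeath

/-! Rescaling removes the rates. The variables `Y k = lam (k+2) * X (k+2)` are i.i.d. standard
exponentials. With `a k = 1 / lam (k+2)`, `T (m+1)` is the weighted sum of the `Y (m+i)` with
weights `a (m+i)`, while `A (m+1)` is the tail sum of `a` from `m`. Everything is then a statement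
about `∑ w i * Y i` with nonnegative summable weights, whose characteristic function is the limit of
the products of `1 / (1 - i t w i)`.

(i) The normalised weights `a (n+i) / tailSum a n` converge in ℓ¹ to `α^i (1-α)`, and the
characteristic function is Lipschitz in the weights for the ℓ¹ norm
(`norm_charFun_weightedSum_sub_le`). The limit law is that of `∑ α^i (1-α) Y i`. It has no atoms, so
Lévy continuity gives convergence of the distribution functions at every point.

(ii) The variance of `T n / A n` is at most the supremum over later indices of `a i / tailSum a i`,
and Chebyshev applies.

(iii) The series of `(a i / tailSum a i) (Y i - 1)` has summable variances, hence converges almost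
surely; the tail form of Kronecker's lemma turns this into `T n / A n → 1`.

(iv) A centred exponential and a standard Gaussian have characteristic functions differing by
`O(|x|^3)`. After division by `B n` the accumulated error is at most `2 |t|^3 (C n / B n)^3`. -/

namespace PureDeath

/-! ### Moments, transforms and scaling of the exponential law. -/

section ExponentialLaw

theorem expMeasure_eq_restrict (r : ℝ) :
    expMeasure r = (volume.restrict (Set.Ioi 0)).withDensity
      (fun x => ENNReal.ofReal (r * Real.exp (-(r * x)))) := by
  have h : expMeasure r = volume.withDensity
      ((Set.Ici (0 : ℝ)).indicator fun x => ENNReal.ofReal (r * Real.exp (-(r * x)))) := by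
    rw [expMeasure, gammaMeasure]
    congr 1
    ext x
    by_cases hx : 0 ≤ x
    · rw [Set.indicator_of_mem (Set.mem_Ici.2 hx)]
      exact exponentialPDF_of_nonneg hx
    · rw [Set.indicator_of_notMem (by simpa using hx)]
      exact gammaPDF_of_neg (not_le.1 hx)
  rw [h, withDensity_indicator measurableSet_Ici,
    Measure.restrict_congr_set Ioi_ae_eq_Ici]

theorem integral_expMeasure {E : Type*} [NormedAddCommGroup E] [NormedSpace ℝ E]
    {r : ℝ} (hr : 0 < r) (g : ℝ → E) :
    ∫ x, g x ∂expMeasure r = ∫ x in Set.Ioi 0, (r * Real.exp (-(r * x))) • g x := by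
  rw [expMeasure_eq_restrict, integral_withDensity_eq_integral_toReal_smul (by fun_prop) (by simp)]
  congr 1
  ext x
  rw [ENNReal.toReal_ofReal (by positivity)]

theorem integrable_expMeasure_iff {E : Type*} [NormedAddCommGroup E] [NormedSpace ℝ E]
    {r : ℝ} (hr : 0 < r) (g : ℝ → E) :
    Integrable g (expMeasure r) ↔
      IntegrableOn (fun x => (r * Real.exp (-(r * x))) • g x) (Set.Ioi 0) := by
  rw [expMeasure_eq_restrict, integrable_withDensity_iff_integrable_smul' (by fun_prop) (by simp),
    IntegrableOn]
  congr! 3 with x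
  rw [ENNReal.toReal_ofReal (by positivity)]

theorem ae_nonneg_expMeasure (r : ℝ) : ∀ᵐ x ∂expMeasure r, 0 ≤ x := by
  rw [expMeasure_eq_restrict]
  refine (withDensity_absolutelyContinuous _ _).ae_le ?_
  filter_upwards [ae_restrict_mem measurableSet_Ioi] with x hx using le_of_lt hx

theorem integrable_pow_expMeasure (n : ℕ) : Integrable (fun x : ℝ => x ^ n) (expMeasure 1) := by
  rw [integrable_expMeasure_iff one_pos]
  refine (Real.GammaIntegral_convergent (s := n + 1) (by positivity)).congr_fun
    (fun x _ => ?_) measurableSet_Ioi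
  simp

theorem integral_pow_expMeasure (n : ℕ) : ∫ x, x ^ n ∂expMeasure 1 = n.factorial := by
  rw [integral_expMeasure one_pos, ← Real.Gamma_nat_eq_factorial,
    Real.Gamma_eq_integral (by positivity)]
  refine setIntegral_congr_fun measurableSet_Ioi (fun x _ => ?_)
  simp

theorem memLp_id_expMeasure : MemLp (fun x : ℝ => x) 2 (expMeasure 1) :=
  (memLp_two_iff_integrable_sq (by fun_prop)).2 (integrable_pow_expMeasure 2)

theorem variance_expMeasure : variance (fun x : ℝ => x) (expMeasure 1) = 1 := by
  have := isProbabilityMeasure_expMeasure one_pos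
  rw [variance_eq_sub memLp_id_expMeasure]
  have h2 := integral_pow_expMeasure 2
  have h1 := integral_pow_expMeasure 1
  simp only [pow_one, Nat.factorial] at h1 h2
  simp only [Pi.pow_apply, h1, h2]
  norm_num

theorem one_sub_mul_I_ne_zero (t : ℝ) : (1 : ℂ) - t * Complex.I ≠ 0 := by
  intro h
  simpa using congrArg Complex.re h

theorem charFun_expMeasure {r : ℝ} (hr : 0 < r) (t : ℝ) :
    charFun (expMeasure r) t = (1 - (t / r : ℝ) * Complex.I)⁻¹ := by
  have hr' : (r : ℂ) ≠ 0 := by exact_mod_cast hr.ne'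
  have h0 := one_sub_mul_I_ne_zero (t / r)
  have hz : (t * Complex.I - r : ℂ) ≠ 0 := by
    intro h
    simpa [hr.ne'] using congrArg Complex.re h
  rw [charFun_apply_real, integral_expMeasure hr]
  have : ∀ x : ℝ, (r * Real.exp (-(r * x))) • Complex.exp (t * x * Complex.I)
      = r * Complex.exp ((t * Complex.I - r) * x) := by
    intro x
    rw [Complex.real_smul]
    push_cast
    rw [mul_assoc, ← Complex.exp_add]
    ring_nf
  simp_rw [this]
  rw [integral_const_mul, integral_exp_mul_complex_Ioi (by simpa using hr)]
  push_cast at h0 ⊢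
  have hz' : (r - t * Complex.I : ℂ) ≠ 0 := by
    rw [← neg_ne_zero]; simpa using hz
  have h1 : (1 - (t / r : ℂ) * Complex.I) = (r - t * Complex.I) / r := by field_simp
  rw [h1, inv_div, mul_div_assoc', ← neg_div_neg_eq (r : ℂ), div_eq_div_iff hz (by simpa using hz)]
  simp

theorem laplace_expMeasure {u : ℝ} (hu : 0 ≤ u) :
    ∫ x, Real.exp (-u * x) ∂expMeasure 1 = (u + 1)⁻¹ := by
  rw [integral_expMeasure one_pos]
  have : ∀ x : ℝ, (1 * Real.exp (-(1 * x))) • Real.exp (-u * x) = Real.exp (-(u + 1) * x) := by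
    intro x
    rw [smul_eq_mul, one_mul, ← Real.exp_add]
    ring_nf
  simp_rw [this]
  rw [integral_exp_mul_Ioi (by linarith), mul_zero, Real.exp_zero, neg_div_neg_eq, one_div]

theorem map_mul_expMeasure {r : ℝ} (hr : 0 < r) :
    (expMeasure r).map (fun x => r * x) = expMeasure 1 := by
  have := isProbabilityMeasure_expMeasure hr
  have := isProbabilityMeasure_expMeasure one_pos
  have : IsProbabilityMeasure ((expMeasure r).map (fun x => r * x)) :=
    Measure.isProbabilityMeasure_map (by fun_prop)
  refine Measure.ext_of_charFun (funext fun t => ?_)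
  rw [charFun_map_mul, charFun_expMeasure hr, charFun_expMeasure one_pos,
    mul_div_cancel_left₀ _ hr.ne', div_one]

theorem expMeasure_singleton (r x : ℝ) : expMeasure r {x} = 0 := by
  rw [expMeasure_eq_restrict]
  exact (withDensity_absolutelyContinuous _ _) (by simp)

end ExponentialLaw

/-- `Y` is a sequence of independent standard exponential random variables. -/
structure IsExpSeq {Ω : Type*} [MeasurableSpace Ω] (P : Measure Ω) (Y : ℕ → Ω → ℝ) : Prop where
  hasLaw : ∀ i, HasLaw (Y i) (expMeasure 1) P
  indep : iIndepFun Y P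

/-- The weighted sum `∑ i, w i * Y i`. -/
noncomputable def weightedSum {Ω : Type*} (w : ℕ → ℝ) (Y : ℕ → Ω → ℝ) (ω : Ω) : ℝ :=
  ∑' i, w i * Y i ω

/-! ### Weighted sums of independent standard exponentials. -/

namespace IsExpSeq

variable {Ω : Type*} [MeasurableSpace Ω] {P : Measure Ω} {Y : ℕ → Ω → ℝ} {w : ℕ → ℝ}

theorem shift (hY : IsExpSeq P Y) (m : ℕ) : IsExpSeq P (fun i => Y (m + i)) where
  hasLaw i := hY.hasLaw (m + i)
  indep := hY.indep.precomp (add_right_injective m)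

theorem aemeasurable (hY : IsExpSeq P Y) (i : ℕ) : AEMeasurable (Y i) P := (hY.hasLaw i).aemeasurable

theorem ae_nonneg (hY : IsExpSeq P Y) : ∀ᵐ ω ∂P, ∀ i, 0 ≤ Y i ω :=
  ae_all_iff.2 fun i => ((hY.hasLaw i).ae_iff (p := fun x => 0 ≤ x)
    (measurableSet_setOfPred.1 measurableSet_Ici)).2 (ae_nonneg_expMeasure 1)

theorem integral_eq (hY : IsExpSeq P Y) (i : ℕ) : ∫ ω, Y i ω ∂P = 1 := by
  rw [(hY.hasLaw i).integral_eq]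
  simpa using integral_pow_expMeasure 1

theorem memLp (hY : IsExpSeq P Y) (i : ℕ) : MemLp (Y i) 2 P := by
  have h := memLp_id_expMeasure
  rw [← (hY.hasLaw i).map_eq] at h
  exact (memLp_map_measure_iff (by fun_prop) (hY.aemeasurable i)).1 h

theorem variance_eq (hY : IsExpSeq P Y) (i : ℕ) : variance (Y i) P = 1 := by
  rw [(hY.hasLaw i).variance_eq]
  exact variance_expMeasure

theorem integrable [IsProbabilityMeasure P] (hY : IsExpSeq P Y) (i : ℕ) : Integrable (Y i) P :=
  (hY.memLp i).integrable (by norm_num)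

theorem lintegral_eq [IsProbabilityMeasure P] (hY : IsExpSeq P Y) (i : ℕ) :
    ∫⁻ ω, ENNReal.ofReal (Y i ω) ∂P = 1 := by
  rw [← ofReal_integral_eq_lintegral_ofReal (hY.integrable i)
    (by filter_upwards [hY.ae_nonneg] with ω h using h i), hY.integral_eq, ENNReal.ofReal_one]

theorem aemeasurable_partialSum (hY : IsExpSeq P Y) (w : ℕ → ℝ) (N : ℕ) :
    AEMeasurable (fun ω => ∑ i ∈ Finset.range N, w i * Y i ω) P :=
  Finset.aemeasurable_fun_sum _ fun i _ => (hY.aemeasurable i).const_mul _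

theorem ae_weightedSum_nonneg (hY : IsExpSeq P Y) (hw0 : ∀ i, 0 ≤ w i) :
    ∀ᵐ ω ∂P, 0 ≤ weightedSum w Y ω := by
  filter_upwards [hY.ae_nonneg] with ω h using tsum_nonneg fun i => mul_nonneg (hw0 i) (h i)

theorem charFun_partialSum (hY : IsExpSeq P Y) (w : ℕ → ℝ) (N : ℕ) (t : ℝ) :
    charFun (P.map fun ω => ∑ i ∈ Finset.range N, w i * Y i ω) t
      = ∏ i ∈ Finset.range N, (1 - (t * w i : ℝ) * Complex.I)⁻¹ := by
  have hind : iIndepFun (fun i ω => w i * Y i ω) P :=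
    hY.indep.comp (fun i x => w i * x) fun i => by fun_prop
  rw [iIndepFun.charFun_map_fun_finsetSum_eq_prod (fun i _ => (hY.aemeasurable i).const_mul _)
    (hind.restrict _), Finset.prod_apply]
  refine Finset.prod_congr rfl fun i _ => ?_
  rw [charFun_map_mul_comp (hY.aemeasurable i), (hY.hasLaw i).map_eq, charFun_expMeasure one_pos,
    div_one, mul_comm t]

theorem integral_exp_partialSum (hY : IsExpSeq P Y) (hw0 : ∀ i, 0 ≤ w i) (N : ℕ) {u : ℝ}
    (hu : 0 ≤ u) :
    ∫ ω, Real.exp (-u * ∑ i ∈ Finset.range N, w i * Y i ω) ∂P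
      = ∏ i ∈ Finset.range N, (u * w i + 1)⁻¹ := by
  have hind : iIndepFun (fun i ω => w i * Y i ω) P :=
    hY.indep.comp (fun i x => w i * x) fun i => by fun_prop
  have h := hind.mgf_sum₀ (t := -u) (fun i => (hY.aemeasurable i).const_mul _) (Finset.range N)
  simp only [mgf, Finset.sum_apply] at h
  rw [h]
  refine Finset.prod_congr rfl fun i _ => ?_
  rw [← laplace_expMeasure (mul_nonneg hu (hw0 i)), ← (hY.hasLaw i).map_eq,
    integral_map (hY.aemeasurable i) (by fun_prop)]
  simp_rw [neg_mul, mul_assoc]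

variable [IsProbabilityMeasure P]

/-- By Tonelli the nonnegative series has finite expectation `∑ w i`, so it is finite almost surely.
-/
theorem ae_summable (hY : IsExpSeq P Y) (hw0 : ∀ i, 0 ≤ w i) (hw : Summable w) :
    ∀ᵐ ω ∂P, Summable (fun i => w i * Y i ω) := by
  have hm : ∀ i, AEMeasurable (fun ω => ENNReal.ofReal (w i * Y i ω)) P :=
    fun i => ((hY.aemeasurable i).const_mul _).ennreal_ofReal
  have h : ∫⁻ ω, ∑' i, ENNReal.ofReal (w i * Y i ω) ∂P ≠ ⊤ := by
    rw [lintegral_tsum hm]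
    have : ∀ i, ∫⁻ ω, ENNReal.ofReal (w i * Y i ω) ∂P = ENNReal.ofReal (w i) := by
      intro i
      simp_rw [ENNReal.ofReal_mul (hw0 i)]
      rw [lintegral_const_mul' _ _ ENNReal.ofReal_ne_top, hY.lintegral_eq, mul_one]
    simp_rw [this]
    exact hw.tsum_ofReal_ne_top
  filter_upwards [ae_lt_top' (AEMeasurable.tsum hm) h, hY.ae_nonneg] with ω h1 h2
  refine (ENNReal.summable_toReal h1.ne).congr fun i => ?_
  rw [ENNReal.toReal_ofReal (mul_nonneg (hw0 i) (h2 i))]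

theorem ae_tendsto (hY : IsExpSeq P Y) (hw0 : ∀ i, 0 ≤ w i) (hw : Summable w) :
    ∀ᵐ ω ∂P, Tendsto (fun N => ∑ i ∈ Finset.range N, w i * Y i ω) atTop
      (𝓝 (weightedSum w Y ω)) := by
  filter_upwards [hY.ae_summable hw0 hw] with ω h using h.hasSum.tendsto_sum_nat

theorem aemeasurable_weightedSum (hY : IsExpSeq P Y) (hw0 : ∀ i, 0 ≤ w i) (hw : Summable w) :
    AEMeasurable (weightedSum w Y) P :=
  aemeasurable_of_tendsto_metrizable_ae atTop (hY.aemeasurable_partialSum w)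
    (hY.ae_tendsto hw0 hw)

theorem isProbabilityMeasure_map (hY : IsExpSeq P Y) (hw0 : ∀ i, 0 ≤ w i) (hw : Summable w) :
    IsProbabilityMeasure (P.map (weightedSum w Y)) :=
  Measure.isProbabilityMeasure_map (hY.aemeasurable_weightedSum hw0 hw)

theorem integral_weightedSum (hY : IsExpSeq P Y) (hw0 : ∀ i, 0 ≤ w i) (hw : Summable w) :
    ∫ ω, weightedSum w Y ω ∂P = ∑' i, w i := by
  have hnorm : ∀ i, ∫ ω, ‖w i * Y i ω‖ ∂P = w i := by
    intro i
    have : (fun ω => ‖w i * Y i ω‖) =ᵐ[P] fun ω => w i * Y i ω := by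
      filter_upwards [hY.ae_nonneg] with ω h
      exact Real.norm_of_nonneg (mul_nonneg (hw0 i) (h i))
    rw [integral_congr_ae this, integral_const_mul, hY.integral_eq, mul_one]
  have := hasSum_integral_of_summable_integral_norm
    (fun i => (hY.integrable i).const_mul (w i)) (by simpa only [hnorm] using hw)
  simp_rw [integral_const_mul, hY.integral_eq, mul_one] at this
  exact this.tsum_eq.symm

theorem integral_partialSum_sq (hY : IsExpSeq P Y) (w : ℕ → ℝ) (N : ℕ) :
    ∫ ω, (∑ i ∈ Finset.range N, w i * Y i ω) ^ 2 ∂P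
      = ∑ i ∈ Finset.range N, w i ^ 2 + (∑ i ∈ Finset.range N, w i) ^ 2 := by
  have hL : ∀ i, MemLp (fun ω => w i * Y i ω) 2 P := fun i => (hY.memLp i).const_mul _
  have hmem : MemLp (∑ i ∈ Finset.range N, fun ω => w i * Y i ω) 2 P :=
    memLp_finsetSum' _ fun i _ => hL i
  have hvar := IndepFun.variance_sum (s := Finset.range N) (fun i _ => hL i)
    (fun i _ j _ hij => (hY.indep.indepFun hij).comp
      (φ := fun x => w i * x) (ψ := fun x => w j * x) (by fun_prop) (by fun_prop))
  rw [variance_eq_sub hmem] at hvar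
  simp_rw [variance_const_mul, hY.variance_eq, mul_one] at hvar
  simp only [Pi.pow_apply, Finset.sum_apply] at hvar
  rw [integral_finsetSum _ fun i _ => (hY.integrable i).const_mul (w i)] at hvar
  simp_rw [integral_const_mul, hY.integral_eq, mul_one] at hvar
  linarith

/-- The partial sums are nonnegative and increasing, so monotone convergence applies to their
squares. Working with `lintegral` yields square integrability and the variance together. -/
theorem lintegral_weightedSum_sq (hY : IsExpSeq P Y) (hw0 : ∀ i, 0 ≤ w i) (hw : Summable w)
    (hw2 : Summable fun i => w i ^ 2) :
    ∫⁻ ω, ENNReal.ofReal (weightedSum w Y ω ^ 2) ∂P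
      = ENNReal.ofReal (∑' i, w i ^ 2 + (∑' i, w i) ^ 2) := by
  have h1 : Tendsto (fun N => ∫⁻ ω, ENNReal.ofReal ((∑ i ∈ Finset.range N, w i * Y i ω) ^ 2) ∂P)
      atTop (𝓝 (∫⁻ ω, ENNReal.ofReal (weightedSum w Y ω ^ 2) ∂P)) := by
    refine lintegral_tendsto_of_tendsto_of_monotone
      (fun N => ((hY.aemeasurable_partialSum w N).pow_const 2).ennreal_ofReal) ?_ ?_
    · filter_upwards [hY.ae_nonneg] with ω h
      intro M N hMN
      have hterm : ∀ i, 0 ≤ w i * Y i ω := fun i => mul_nonneg (hw0 i) (h i)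
      refine ENNReal.ofReal_le_ofReal (pow_le_pow_left₀ (Finset.sum_nonneg fun i _ => hterm i) ?_ 2)
      exact Finset.sum_le_sum_of_subset_of_nonneg (Finset.range_mono hMN) fun i _ _ => hterm i
    · filter_upwards [hY.ae_tendsto hw0 hw] with ω h
      exact ENNReal.tendsto_ofReal (h.pow 2)
  have h2 : ∀ N, ∫⁻ ω, ENNReal.ofReal ((∑ i ∈ Finset.range N, w i * Y i ω) ^ 2) ∂P
      = ENNReal.ofReal (∑ i ∈ Finset.range N, w i ^ 2 + (∑ i ∈ Finset.range N, w i) ^ 2) := by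
    intro N
    rw [← hY.integral_partialSum_sq, ofReal_integral_eq_lintegral_ofReal _
      (Eventually.of_forall fun ω => sq_nonneg _)]
    refine MemLp.integrable_sq ?_
    exact memLp_finsetSum _ fun i _ => (hY.memLp i).const_mul (w i)
  simp_rw [h2] at h1
  exact tendsto_nhds_unique h1 (ENNReal.tendsto_ofReal
    (hw2.hasSum.tendsto_sum_nat.add (hw.hasSum.tendsto_sum_nat.pow 2)))

theorem memLp_weightedSum (hY : IsExpSeq P Y) (hw0 : ∀ i, 0 ≤ w i) (hw : Summable w)
    (hw2 : Summable fun i => w i ^ 2) : MemLp (weightedSum w Y) 2 P := by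
  have hm := hY.aemeasurable_weightedSum hw0 hw
  refine (memLp_two_iff_integrable_sq hm.aestronglyMeasurable).2
    ⟨(hm.pow_const 2).aestronglyMeasurable, ?_⟩
  rw [hasFiniteIntegral_iff_ofReal (Eventually.of_forall fun ω => sq_nonneg _),
    hY.lintegral_weightedSum_sq hw0 hw hw2]
  exact ENNReal.ofReal_lt_top

theorem variance_weightedSum (hY : IsExpSeq P Y) (hw0 : ∀ i, 0 ≤ w i) (hw : Summable w)
    (hw2 : Summable fun i => w i ^ 2) : variance (weightedSum w Y) P = ∑' i, w i ^ 2 := by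
  have hL := hY.memLp_weightedSum hw0 hw hw2
  rw [variance_eq_sub hL, hY.integral_weightedSum hw0 hw]
  simp only [Pi.pow_apply]
  rw [integral_eq_lintegral_of_nonneg_ae (Eventually.of_forall fun ω => sq_nonneg _)
    hL.integrable_sq.aestronglyMeasurable, hY.lintegral_weightedSum_sq hw0 hw hw2,
    ENNReal.toReal_ofReal (add_nonneg (tsum_nonneg fun i => sq_nonneg _) (sq_nonneg _))]
  ring

theorem tendsto_charFun_weightedSum (hY : IsExpSeq P Y) (hw0 : ∀ i, 0 ≤ w i) (hw : Summable w)
    (t : ℝ) :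
    Tendsto (fun N => ∏ i ∈ Finset.range N, (1 - (t * w i : ℝ) * Complex.I)⁻¹) atTop
      (𝓝 (charFun (P.map (weightedSum w Y)) t)) := by
  simp_rw [← hY.charFun_partialSum, charFun_apply_real]
  rw [integral_map (hY.aemeasurable_weightedSum hw0 hw) (by fun_prop)]
  have h : ∀ N, ∫ x, Complex.exp (t * x * Complex.I)
      ∂(P.map fun ω => ∑ i ∈ Finset.range N, w i * Y i ω)
      = ∫ ω, Complex.exp (t * (∑ i ∈ Finset.range N, w i * Y i ω : ℝ) * Complex.I) ∂P :=
    fun N => integral_map (hY.aemeasurable_partialSum w N) (by fun_prop)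
  simp_rw [h]
  have hc : Continuous fun x : ℝ => Complex.exp (t * x * Complex.I) := by fun_prop
  refine tendsto_integral_of_dominated_convergence (fun _ => 1)
    (fun N => (hc.measurable.comp_aemeasurable
      (hY.aemeasurable_partialSum w N)).aestronglyMeasurable) (integrable_const _)
    (fun N => Eventually.of_forall fun ω => ?_) ?_
  · rw [← Complex.ofReal_mul, Complex.norm_exp_ofReal_mul_I]
  · filter_upwards [hY.ae_tendsto hw0 hw] with ω h
    exact (hc.tendsto _).comp h

theorem hasProd_laplace_weightedSum (hY : IsExpSeq P Y) (hw0 : ∀ i, 0 ≤ w i) (hw : Summable w)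
    {u : ℝ} (hu : 0 ≤ u) :
    HasProd (fun i => (u * w i + 1)⁻¹)
      (∫ x in Set.Ici (0 : ℝ), Real.exp (-u * x) ∂(P.map (weightedSum w Y))) := by
  have hS := hY.aemeasurable_weightedSum hw0 hw
  have hnn := hY.ae_weightedSum_nonneg hw0
  have hrestrict : (P.map (weightedSum w Y)).restrict (Set.Ici 0) = P.map (weightedSum w Y) :=
    Measure.restrict_eq_self_of_ae_mem ((ae_map_iff hS measurableSet_Ici).2 hnn)
  rw [hrestrict, integral_map hS (by fun_prop)]
  have hlim : Tendsto (fun N => ∏ i ∈ Finset.range N, (u * w i + 1)⁻¹) atTop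
      (𝓝 (∫ ω, Real.exp (-u * weightedSum w Y ω) ∂P)) := by
    simp_rw [← hY.integral_exp_partialSum hw0 _ hu]
    have hc : Continuous fun x : ℝ => Real.exp (-u * x) := by fun_prop
    refine tendsto_integral_of_dominated_convergence (fun _ => 1)
      (fun N => (hc.measurable.comp_aemeasurable
        (hY.aemeasurable_partialSum w N)).aestronglyMeasurable) (integrable_const _)
      (fun N => ?_) ?_
    · filter_upwards [hY.ae_nonneg] with ω h
      rw [Real.norm_of_nonneg (Real.exp_pos _).le, Real.exp_le_one_iff, neg_mul, neg_nonpos]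
      exact mul_nonneg hu (Finset.sum_nonneg fun i _ => mul_nonneg (hw0 i) (h i))
    · filter_upwards [hY.ae_tendsto hw0 hw] with ω h
      exact (hc.tendsto _).comp h
  -- Dominated convergence gives only the limit along initial segments. Unconditional convergence
  -- comes from inverting the product of `1 + u w i`, which converges to a value at least 1.
  have hmul : Multipliable fun i => u * w i + 1 :=
    (Real.multipliable_one_add_of_summable (hw.mul_left u)).congr fun i => add_comm _ _
  have hone : ∀ s : Finset ℕ, 1 ≤ ∏ i ∈ s, (u * w i + 1) := fun s =>
    Finset.one_le_prod fun i _ => le_add_of_nonneg_left (mul_nonneg hu (hw0 i))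
  have hprod := hmul.hasProd.inv₀
    (one_pos.trans_le (ge_of_tendsto' hmul.hasProd hone)).ne'
  rwa [tendsto_nhds_unique hlim hprod.tendsto_prod_nat]

theorem map_weightedSum_eq_conv (hY : IsExpSeq P Y) (hw0 : ∀ i, 0 ≤ w i) (hw : Summable w) :
    P.map (weightedSum w Y) = ((expMeasure 1).map (fun x => w 0 * x)).conv
      (P.map (weightedSum (fun i => w (i + 1)) Y)) := by
  have hw' := (summable_nat_add_iff 1).2 hw
  have := isProbabilityMeasure_expMeasure one_pos
  have := hY.isProbabilityMeasure_map hw0 hw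
  have := hY.isProbabilityMeasure_map (fun i => hw0 (i + 1)) hw'
  have : IsProbabilityMeasure ((expMeasure 1).map (fun x => w 0 * x)) :=
    Measure.isProbabilityMeasure_map (by fun_prop)
  refine Measure.ext_of_charFun (funext fun t => ?_)
  rw [charFun_conv, charFun_map_mul, charFun_expMeasure one_pos]
  refine tendsto_nhds_unique
    ((hY.tendsto_charFun_weightedSum hw0 hw t).comp (tendsto_add_atTop_nat 1)) ?_
  refine ((hY.tendsto_charFun_weightedSum (fun i => hw0 (i + 1)) hw' t).const_mul _).congr
    fun N => ?_
  simp only [Function.comp_apply]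
  rw [Finset.prod_range_succ', div_one, mul_comm (w 0) t, mul_comm]

/-- A single nondegenerate exponential summand suffices: convolving an atomless law with any
probability measure leaves no atoms. -/
theorem map_weightedSum_singleton (hY : IsExpSeq P Y) (hw0 : ∀ i, 0 ≤ w i) (hw : Summable w)
    (h0 : 0 < w 0) (x : ℝ) : P.map (weightedSum w Y) {x} = 0 := by
  have hw' := (summable_nat_add_iff 1).2 hw
  have := isProbabilityMeasure_expMeasure one_pos
  have := hY.isProbabilityMeasure_map (fun i => hw0 (i + 1)) hw'
  have : IsProbabilityMeasure ((expMeasure 1).map (fun x => w 0 * x)) :=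
    Measure.isProbabilityMeasure_map (by fun_prop)
  rw [hY.map_weightedSum_eq_conv hw0 hw, Measure.conv_comm,
    ← lintegral_indicator_one (measurableSet_singleton x),
    Measure.lintegral_conv (measurable_one.indicator (measurableSet_singleton x))]
  refine lintegral_eq_zero_of_ae_eq_zero (Eventually.of_forall fun y => ?_)
  simp only [Pi.zero_apply]
  have hmeas : Measurable fun z => ({x} : Set ℝ).indicator (1 : ℝ → ENNReal) (y + z) :=
    (measurable_one.indicator (measurableSet_singleton x)).comp (measurable_const_add y)
  rw [lintegral_map hmeas (by fun_prop)]
  refine lintegral_eq_zero_of_ae_eq_zero ?_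
  filter_upwards [compl_mem_ae_iff.2 (expMeasure_singleton 1 ((x - y) / w 0))] with z hz
  refine Set.indicator_of_notMem (fun hmem => hz ?_) _
  rw [Set.mem_singleton_iff] at hmem ⊢
  rw [eq_div_iff h0.ne']
  linarith

end IsExpSeq

/-! ### Almost sure convergence of random series, and Kronecker's lemma. -/

section Series

variable {Ω : Type*} [MeasurableSpace Ω] {P : Measure Ω}

/-- From `|s| ≤ 1 + s²` and additivity of variance; this is the L¹ bound required for martingale
convergence. -/
theorem integral_norm_sum_le_of_iIndepFun [IsProbabilityMeasure P] {Z : ℕ → Ω → ℝ}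
    (hL : ∀ i, MemLp (Z i) 2 P) (hmean : ∀ i, ∫ ω, Z i ω ∂P = 0) (hind : iIndepFun Z P)
    (s : Finset ℕ) : ∫ ω, ‖(∑ i ∈ s, Z i) ω‖ ∂P ≤ 1 + ∑ i ∈ s, variance (Z i) P := by
  have hS : MemLp (∑ i ∈ s, Z i) 2 P := memLp_finsetSum' _ fun i _ => hL i
  have hvar := IndepFun.variance_sum (s := s) (fun i _ => hL i)
    (fun i _ j _ hij => hind.indepFun hij)
  have hmeanS : ∫ ω, (∑ i ∈ s, Z i) ω ∂P = 0 := by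
    simp_rw [Finset.sum_apply]
    rw [integral_finsetSum _ fun i _ => (hL i).integrable (by norm_num)]
    simp [hmean]
  rw [variance_eq_sub hS, hmeanS] at hvar
  have hsq : ∫ ω, (∑ i ∈ s, Z i) ω ^ 2 ∂P = ∑ i ∈ s, variance (Z i) P := by
    simpa using hvar
  calc ∫ ω, ‖(∑ i ∈ s, Z i) ω‖ ∂P ≤ ∫ ω, (1 + (∑ i ∈ s, Z i) ω ^ 2) ∂P := by
        refine integral_mono (hS.integrable (by norm_num)).norm
          ((integrable_const 1).add hS.integrable_sq) fun ω => ?_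
        simp only [Real.norm_eq_abs]
        nlinarith [sq_abs ((∑ i ∈ s, Z i) ω), sq_nonneg (|(∑ i ∈ s, Z i) ω| - 1),
          abs_nonneg ((∑ i ∈ s, Z i) ω)]
    _ = 1 + ∑ i ∈ s, variance (Z i) P := by
        rw [integral_add (integrable_const 1) hS.integrable_sq, hsq]
        simp

/-- The partial sums form an L¹-bounded martingale for the natural filtration, which is why
genuinely measurable versions are needed here. -/
theorem ae_exists_tendsto_sum_of_stronglyMeasurable [IsProbabilityMeasure P] {Z : ℕ → Ω → ℝ}
    (hm : ∀ i, StronglyMeasurable (Z i)) (hL : ∀ i, MemLp (Z i) 2 P)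
    (hmean : ∀ i, ∫ ω, Z i ω ∂P = 0) (hind : iIndepFun Z P)
    (hvar : Summable fun i => variance (Z i) P) :
    ∀ᵐ ω ∂P, ∃ c, Tendsto (fun N => ∑ i ∈ Finset.range N, Z i ω) atTop (𝓝 c) := by
  have hint : ∀ i, Integrable (Z i) P := fun i => (hL i).integrable (by norm_num)
  have hmart : Martingale (fun n => ∑ i ∈ Finset.range (n + 1), Z i)
      (Filtration.natural Z hm) P := by
    refine martingale_of_condExp_sub_eq_zero_nat (fun n => ?_) (fun n => ?_) fun n => ?_
    · refine Finset.stronglyMeasurable_sum _ fun i hi => ?_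
      exact ((Filtration.stronglyAdapted_natural hm) i).mono
        ((Filtration.natural Z hm).mono (Nat.lt_succ_iff.1 (Finset.mem_range.1 hi)))
    · exact integrable_finsetSum' _ fun i _ => hint i
    · have : (∑ i ∈ Finset.range (n + 1 + 1), Z i) - ∑ i ∈ Finset.range (n + 1), Z i
          = Z (n + 1) := by
        rw [Finset.sum_range_succ, add_sub_cancel_left]
      simp only [this]
      filter_upwards [hind.condExp_natural_ae_eq_of_lt hm (Nat.lt_succ_self n)] with ω h
      simpa [hmean] using h
  have hbdd : ∀ n, eLpNorm (∑ i ∈ Finset.range (n + 1), Z i) 1 P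
      ≤ ((1 + ∑' i, variance (Z i) P).toNNReal : ENNReal) := by
    intro n
    have hi : Integrable (∑ i ∈ Finset.range (n + 1), Z i) P :=
      integrable_finsetSum' _ fun i _ => hint i
    rw [eLpNorm_one_eq_lintegral_enorm, ← ofReal_integral_norm_eq_lintegral_enorm hi]
    refine ENNReal.ofReal_le_ofReal ((integral_norm_sum_le_of_iIndepFun hL hmean hind _).trans ?_)
    gcongr
    exact hvar.sum_le_tsum _ fun i _ => variance_nonneg _ _
  filter_upwards [hmart.submartingale.exists_ae_tendsto_of_bdd hbdd] with ω ⟨c, hc⟩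
  refine ⟨c, (tendsto_add_atTop_iff_nat 1).1 ?_⟩
  simpa only [Finset.sum_apply] using hc

/-- A series of independent centred random variables with summable variances converges almost
surely. -/
theorem ae_exists_tendsto_sum [IsProbabilityMeasure P] {Z : ℕ → Ω → ℝ}
    (hL : ∀ i, MemLp (Z i) 2 P) (hmean : ∀ i, ∫ ω, Z i ω ∂P = 0) (hind : iIndepFun Z P)
    (hvar : Summable fun i => variance (Z i) P) :
    ∀ᵐ ω ∂P, ∃ c, Tendsto (fun N => ∑ i ∈ Finset.range N, Z i ω) atTop (𝓝 c) := by
  have hae : ∀ i, Z i =ᵐ[P] (hL i).1.mk (Z i) := fun i => (hL i).1.ae_eq_mk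
  have h := ae_exists_tendsto_sum_of_stronglyMeasurable
    (fun i => (hL i).1.stronglyMeasurable_mk) (fun i => (memLp_congr_ae (hae i)).1 (hL i))
    (fun i => (integral_congr_ae (hae i)).symm.trans (hmean i)) (hind.congr hae)
    (hvar.congr fun i => variance_congr (hae i))
  filter_upwards [h, ae_all_iff.2 hae] with ω hω heq
  simpa only [heq] using hω

/-- Kronecker's lemma for tails: if `∑ x i / d i` converges and `d` decreases, then the tails of
`∑ x i` are negligible with respect to `d`. -/
theorem tendsto_tsum_tail_div_zero {d x : ℕ → ℝ} (hd : ∀ n, 0 < d n) (hanti : Antitone d)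
    (hx : Summable x) {c : ℝ}
    (hc : Tendsto (fun N => ∑ i ∈ Finset.range N, x i / d i) atTop (𝓝 c)) :
    Tendsto (fun n => (∑' i, x (n + i)) / d n) atTop (𝓝 0) := by
  rw [Metric.tendsto_atTop]
  intro ε hε
  obtain ⟨N, hN⟩ := Metric.cauchySeq_iff.1 hc.cauchySeq (ε / 2) (half_pos hε)
  refine ⟨N, fun n hn => ?_⟩
  set s : ℕ → ℝ := fun N => ∑ i ∈ Finset.range N, x i / d i
  have hp : ∀ k, |s (n + k) - s n| ≤ ε / 2 := fun k => (hN _ (by omega) _ hn).le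
  have hstep : ∀ k, x (n + k) = d (n + k) * (s (n + (k + 1)) - s (n + k)) := by
    intro k
    simp only [s, ← add_assoc, Finset.sum_range_succ, add_sub_cancel_left]
    rw [mul_div_cancel₀ _ (hd _).ne']
  -- Summation by parts: once the boundary term is removed, each remaining increment of `s` is at
  -- most `ε / 2` and is weighted by a decrement of `d`; the decrements telescope.
  have habel : ∀ k, |∑ i ∈ Finset.range k, x (n + i) - d (n + k) * (s (n + k) - s n)|
      ≤ ε / 2 * (d n - d (n + k)) := by
    intro k
    induction k with
    | zero => simp
    | succ k ih =>
      have h1 : ∑ i ∈ Finset.range (k + 1), x (n + i)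
            - d (n + (k + 1)) * (s (n + (k + 1)) - s n)
          = (∑ i ∈ Finset.range k, x (n + i) - d (n + k) * (s (n + k) - s n))
            + (d (n + k) - d (n + (k + 1))) * (s (n + (k + 1)) - s n) := by
        rw [Finset.sum_range_succ, hstep k]
        ring
      have h2 : 0 ≤ d (n + k) - d (n + (k + 1)) := sub_nonneg.2 (hanti (by omega))
      rw [h1]
      refine (abs_add_le _ _).trans ?_
      rw [abs_mul, abs_of_nonneg h2]
      nlinarith [mul_le_mul_of_nonneg_left (hp (k + 1)) h2]
  have hbound : ∀ k, |∑ i ∈ Finset.range k, x (n + i)| ≤ ε / 2 * d n := by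
    intro k
    have h1 : |d (n + k) * (s (n + k) - s n)| ≤ d (n + k) * (ε / 2) := by
      rw [abs_mul, abs_of_pos (hd _)]
      exact mul_le_mul_of_nonneg_left (hp k) (hd _).le
    have h2 := abs_sub_abs_le_abs_sub (∑ i ∈ Finset.range k, x (n + i))
      (d (n + k) * (s (n + k) - s n))
    linarith [habel k]
  have htail : |∑' i, x (n + i)| ≤ ε / 2 * d n := by
    have hsum : Summable fun i => x (n + i) := hx.comp_injective (add_right_injective n)
    exact le_of_tendsto' hsum.hasSum.tendsto_sum_nat.abs hbound
  rw [Real.dist_eq, sub_zero, abs_div, abs_of_pos (hd n), div_lt_iff₀ (hd n)]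
  nlinarith [hd n, mul_pos hε (hd n)]

end Series

/-! ### Tail sums and the two laws of large numbers. -/

section Tails

variable {a : ℕ → ℝ}

/-- The tail sums `∑ i ≥ n, a i`. -/
noncomputable def tailSum (a : ℕ → ℝ) (n : ℕ) : ℝ := ∑' i, a (n + i)

theorem summable_tail (ha : Summable a) (n : ℕ) : Summable fun i => a (n + i) :=
  ha.comp_injective (add_right_injective n)

theorem tailSum_eq_add (ha : Summable a) (n : ℕ) : tailSum a n = a n + tailSum a (n + 1) := by
  rw [tailSum, (summable_tail ha n).tsum_eq_zero_add, tailSum]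
  simp only [add_zero, add_assoc, add_comm 1]

theorem tailSum_pos (h0 : ∀ i, 0 < a i) (ha : Summable a) (n : ℕ) : 0 < tailSum a n :=
  (summable_tail ha n).tsum_pos (fun _ => (h0 _).le) 0 (h0 _)

theorem antitone_tailSum (h0 : ∀ i, 0 < a i) (ha : Summable a) : Antitone (tailSum a) :=
  antitone_nat_of_succ_le fun n => by linarith [tailSum_eq_add ha n, h0 n]

theorem summable_pow_of_summable (h0 : ∀ i, 0 < a i) (ha : Summable a) {k : ℕ} (hk : k ≠ 0) :
    Summable fun i => a i ^ k := by
  refine summable_of_isBigO_nat ha ?_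
  obtain ⟨j, rfl⟩ := Nat.exists_eq_succ_of_ne_zero hk
  refine IsBigO.of_bound 1 ?_
  filter_upwards [ha.tendsto_atTop_zero.eventually (eventually_le_nhds one_pos)] with i hi
  rw [one_mul, Real.norm_of_nonneg (pow_nonneg (h0 i).le _), Real.norm_of_nonneg (h0 i).le,
    pow_succ]
  exact mul_le_of_le_one_left (h0 i).le (pow_le_one₀ (h0 i).le hi)

variable {Ω : Type*} [MeasurableSpace Ω] {P : Measure Ω} [IsProbabilityMeasure P] {Y : ℕ → Ω → ℝ}

/-- Kronecker's lemma with `x i = a i (Y i - 1)` and `d = tailSum a`: the tail of `x` is the random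
tail minus its mean. -/
theorem IsExpSeq.ae_tendsto_weightedSum_div_tailSum (hY : IsExpSeq P Y) (h0 : ∀ i, 0 < a i)
    (ha : Summable a) (hsq : Summable fun i => (a i / tailSum a i) ^ 2) :
    ∀ᵐ ω ∂P, Tendsto (fun n => weightedSum (fun i => a (n + i)) (fun i => Y (n + i)) ω
      / tailSum a n) atTop (𝓝 1) := by
  have hZ := ae_exists_tendsto_sum (P := P) (Z := fun i ω => a i / tailSum a i * (Y i ω - 1))
    (fun i => ((hY.memLp i).sub (memLp_const 1)).const_mul _)
    (fun i => by
      rw [integral_const_mul, integral_sub (hY.integrable i) (integrable_const 1), hY.integral_eq]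
      simp)
    (hY.indep.comp (fun i x => a i / tailSum a i * (x - 1)) fun i => by fun_prop)
    (hsq.congr fun i => by
      rw [variance_const_mul, variance_sub_const (hY.aemeasurable i).aestronglyMeasurable,
        hY.variance_eq, mul_one])
  filter_upwards [hZ, hY.ae_summable (fun i => (h0 i).le) ha] with ω ⟨c, hc⟩ hs
  have hx : Summable fun i => a i * Y i ω - a i := hs.sub ha
  have h := (tendsto_tsum_tail_div_zero (tailSum_pos h0 ha) (antitone_tailSum h0 ha) hx
    (hc.congr fun N => Finset.sum_congr rfl fun i _ => by ring)).add_const 1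
  rw [zero_add] at h
  refine h.congr fun n => ?_
  have hne := (tailSum_pos h0 ha n).ne'
  rw [(summable_tail hs n).tsum_sub (summable_tail ha n), div_add_one hne]
  congr 1
  exact sub_add_cancel _ _

theorem IsExpSeq.tendstoInMeasure_weightedSum_div_tailSum (hY : IsExpSeq P Y) (h0 : ∀ i, 0 < a i)
    (ha : Summable a) (hsmall : a =o[atTop] tailSum a) :
    TendstoInMeasure P (fun n ω => weightedSum (fun i => a (n + i)) (fun i => Y (n + i)) ω
      / tailSum a n) atTop (fun _ => (1 : ℝ)) := by
  have hpos := tailSum_pos h0 ha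
  have h2 := summable_pow_of_summable h0 ha two_ne_zero
  have hvar : Tendsto (fun n => (∑' i, a (n + i) ^ 2) / tailSum a n ^ 2) atTop (𝓝 0) := by
    rw [Metric.tendsto_atTop]
    intro ε hε
    obtain ⟨N, hN⟩ := eventually_atTop.1 (hsmall.bound (half_pos hε))
    refine ⟨N, fun n hn => ?_⟩
    -- One factor of each square is at most `ε / 2` times its own tail sum, hence `ε / 2` times the
    -- larger `tailSum a n`; the other factors add up to `tailSum a n`.
    have hle : ∑' i, a (n + i) ^ 2 ≤ ε / 2 * tailSum a n * tailSum a n := by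
      have hterm : ∀ i, a (n + i) ^ 2 ≤ ε / 2 * tailSum a n * a (n + i) := by
        intro i
        have h := hN (n + i) (by omega)
        rw [Real.norm_of_nonneg (h0 _).le, Real.norm_of_nonneg (hpos _).le] at h
        rw [sq]
        refine mul_le_mul_of_nonneg_right (h.trans ?_) (h0 _).le
        exact mul_le_mul_of_nonneg_left (antitone_tailSum h0 ha (by omega)) (half_pos hε).le
      refine ((summable_tail h2 n).tsum_le_tsum hterm ((summable_tail ha n).mul_left _)).trans ?_
      rw [tsum_mul_left, tailSum]
    rw [Real.dist_eq, sub_zero, abs_of_nonneg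
      (div_nonneg (tsum_nonneg fun i => sq_nonneg _) (sq_nonneg _)),
      div_lt_iff₀ (pow_pos (hpos n) 2)]
    nlinarith [mul_pos hε (pow_pos (hpos n) 2)]
  rw [tendstoInMeasure_iff_norm]
  intro δ hδ
  have hlim : Tendsto (fun n => ENNReal.ofReal
      ((∑' i, a (n + i) ^ 2) / tailSum a n ^ 2 / δ ^ 2)) atTop (𝓝 0) := by
    have := ENNReal.tendsto_ofReal (hvar.div_const (δ ^ 2))
    simpa using this
  refine tendsto_of_tendsto_of_tendsto_of_le_of_le tendsto_const_nhds hlim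
    (fun _ => zero_le) fun n => ?_
  have hnn : ∀ i, 0 ≤ a (n + i) := fun i => (h0 _).le
  have hL := (hY.shift n).memLp_weightedSum hnn (summable_tail ha n) (summable_tail h2 n)
  have hcheb := meas_ge_le_variance_div_sq
    (X := fun ω => weightedSum (fun i => a (n + i)) (fun i => Y (n + i)) ω / tailSum a n)
    (by simpa only [div_eq_mul_inv] using hL.mul_const (tailSum a n)⁻¹) hδ
  simp_rw [div_eq_inv_mul _ (tailSum a n)] at hcheb
  rw [integral_const_mul, variance_const_mul, (hY.shift n).integral_weightedSum hnn
    (summable_tail ha n), (hY.shift n).variance_weightedSum hnn (summable_tail ha n)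
    (summable_tail h2 n), show ∑' i, a (n + i) = tailSum a n from rfl,
    inv_mul_cancel₀ (hpos n).ne'] at hcheb
  simp_rw [div_eq_inv_mul _ (tailSum a n), div_eq_inv_mul _ (tailSum a n ^ 2), ← inv_pow]
  exact hcheb

end Tails

/-! ### Comparison of characteristic functions. -/

section CharFun

/-- Replace the factors one at a time; the untouched ones have norm at most 1. -/
theorem norm_prod_sub_prod_le_sum {R ι : Type*} [NormedCommRing R] [NormOneClass R] {z w : ι → R}
    (s : Finset ι) (hz : ∀ i ∈ s, ‖z i‖ ≤ 1) (hw : ∀ i ∈ s, ‖w i‖ ≤ 1) :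
    ‖∏ i ∈ s, z i - ∏ i ∈ s, w i‖ ≤ ∑ i ∈ s, ‖z i - w i‖ := by
  classical
  induction s using Finset.induction_on with
  | empty => simp
  | insert j s hj ih =>
    rw [Finset.forall_mem_insert] at hz hw
    rw [Finset.prod_insert hj, Finset.prod_insert hj, Finset.sum_insert hj]
    have hprod : ‖∏ i ∈ s, w i‖ ≤ 1 :=
      (Finset.norm_prod_le _ _).trans (Finset.prod_le_one (fun i _ => norm_nonneg _) hw.2)
    calc ‖z j * ∏ i ∈ s, z i - w j * ∏ i ∈ s, w i‖
        = ‖z j * (∏ i ∈ s, z i - ∏ i ∈ s, w i) + (z j - w j) * ∏ i ∈ s, w i‖ := by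
          congr 1; ring
      _ ≤ ‖z j‖ * ‖∏ i ∈ s, z i - ∏ i ∈ s, w i‖ + ‖z j - w j‖ * ‖∏ i ∈ s, w i‖ :=
          (norm_add_le _ _).trans (add_le_add (norm_mul_le _ _) (norm_mul_le _ _))
      _ ≤ 1 * ∑ i ∈ s, ‖z i - w i‖ + ‖z j - w j‖ * 1 := by
          gcongr
          · exact hz.1
          · exact ih hz.2 hw.2
      _ = ‖z j - w j‖ + ∑ i ∈ s, ‖z i - w i‖ := by ring

theorem norm_inv_one_sub_mul_I_le (x : ℝ) : ‖(1 - (x : ℂ) * Complex.I)⁻¹‖ ≤ 1 := by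
  rw [norm_inv]
  refine inv_le_one_of_one_le₀ ?_
  simpa using Complex.abs_re_le_norm (1 - (x : ℂ) * Complex.I)

theorem norm_inv_one_sub_mul_I_sub_le (x y : ℝ) :
    ‖(1 - (x : ℂ) * Complex.I)⁻¹ - (1 - (y : ℂ) * Complex.I)⁻¹‖ ≤ |x - y| := by
  have hx := one_sub_mul_I_ne_zero x
  have hy := one_sub_mul_I_ne_zero y
  have h : (1 - (x : ℂ) * Complex.I)⁻¹ - (1 - (y : ℂ) * Complex.I)⁻¹
      = (1 - (x : ℂ) * Complex.I)⁻¹ * ((x - y : ℝ) * Complex.I) * (1 - (y : ℂ) * Complex.I)⁻¹ := by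
    rw [inv_sub_inv' hx hy]
    congr 2
    push_cast
    ring
  rw [h, norm_mul, norm_mul, norm_mul, Complex.norm_I, mul_one, Complex.norm_real,
    Real.norm_eq_abs]
  calc _ ≤ 1 * |x - y| * 1 := by
        gcongr
        · exact norm_inv_one_sub_mul_I_le x
        · exact norm_inv_one_sub_mul_I_le y
    _ = |x - y| := by ring

/-- The characteristic function of a centred standard exponential variable agrees with that of the
standard Gaussian up to third order. -/
theorem norm_exp_mul_inv_sub_exp_le (x : ℝ) :
    ‖Complex.exp (-(x * Complex.I)) * (1 - (x : ℂ) * Complex.I)⁻¹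
      - Complex.exp (-(x ^ 2 / 2 : ℝ))‖ ≤ 2 * |x| ^ 3 := by
  have hinv := norm_inv_one_sub_mul_I_le x
  have hne := one_sub_mul_I_ne_zero x
  have hexp : ‖Complex.exp (-(x * Complex.I))‖ = 1 := by
    simpa using Complex.norm_exp_ofReal_mul_I (-x)
  have hgauss : ‖Complex.exp (-(x ^ 2 / 2 : ℝ))‖ ≤ 1 := by
    rw [← Complex.ofReal_neg, Complex.norm_exp_ofReal, Real.exp_le_one_iff]
    nlinarith [sq_nonneg x]
  rcases le_total 1 |x| with h1 | h1
  -- Both terms have norm at most 1, so the difference is at most 2; this case fixes the constant.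
  · refine (norm_sub_le _ _).trans ?_
    rw [norm_mul, hexp, one_mul]
    linarith [one_le_pow₀ h1 (n := 3)]
  · have hb1 := Complex.exp_bound (x := -(x * Complex.I)) (by simpa using h1) (n := 3) (by norm_num)
    have hsq : x ^ 2 ≤ 1 := by rw [← sq_abs]; exact pow_le_one₀ (abs_nonneg x) h1
    have hnorm : ‖(-(x ^ 2 / 2 : ℝ) : ℂ)‖ = x ^ 2 / 2 := by
      rw [norm_neg, Complex.norm_real, Real.norm_of_nonneg (by positivity)]
    have hb2 := Complex.exp_bound (x := (-(x ^ 2 / 2 : ℝ) : ℂ)) (by rw [hnorm]; linarith)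
      (n := 2) (by norm_num)
    rw [hnorm] at hb2
    simp only [Finset.sum_range_succ, Finset.sum_range_zero, norm_neg, norm_mul, Complex.norm_I,
      Complex.norm_real, Real.norm_eq_abs, Nat.factorial, mul_one] at hb1 hb2
    set e := Complex.exp (-(x * Complex.I))
    set g := Complex.exp (-(x ^ 2 / 2 : ℝ))
    have hI : Complex.I ^ 2 = -1 := Complex.I_sq
    -- The identity `(1 - ix)(1 - x²/2) = (1 - ix - x²/2) + i x³/2` matches the two Taylor
    -- polynomials up to a cubic term. The errors total `2/9 + 1/2 + 3/16 < 2` times `|x|^3`.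
    have key : e * (1 - (x : ℂ) * Complex.I)⁻¹ - g
        = (1 - (x : ℂ) * Complex.I)⁻¹ *
            ((e - (1 - x * Complex.I - x ^ 2 / 2)) - (x ^ 3 / 2 : ℝ) * Complex.I)
          - (g - (1 - x ^ 2 / 2)) := by
      field_simp
      push_cast
      ring
    have e1 : ‖e - (1 - x * Complex.I - x ^ 2 / 2)‖ ≤ |x| ^ 3 * (2 / 9) := by
      refine le_trans (le_of_eq ?_) (hb1.trans (le_of_eq ?_))
      · congr 2
        push_cast
        linear_combination (-(x : ℂ) ^ 2 / 2) * hI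
      · norm_num
    have e2 : ‖g - (1 - x ^ 2 / 2)‖ ≤ |x| ^ 3 * (3 / 16) := by
      refine le_trans (le_of_eq ?_) (hb2.trans ?_)
      · congr 2
        push_cast
        ring
      · have h4 : (x ^ 2) ^ 2 = |x| ^ 4 := by rw [← pow_mul, Even.pow_abs ⟨2, rfl⟩]
        rw [div_pow, h4]
        have : |x| ^ 4 ≤ |x| ^ 3 := pow_le_pow_of_le_one (abs_nonneg x) h1 (by norm_num)
        norm_num
        nlinarith
    have e3 : ‖((x ^ 3 / 2 : ℝ) : ℂ) * Complex.I‖ = |x| ^ 3 / 2 := by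
      rw [norm_mul, Complex.norm_I, mul_one, Complex.norm_real, Real.norm_eq_abs, abs_div, abs_pow,
        abs_of_pos (two_pos : (0 : ℝ) < 2)]
    rw [key]
    refine (norm_sub_le _ _).trans ?_
    rw [norm_mul]
    have h4 := (norm_sub_le (e - (1 - x * Complex.I - x ^ 2 / 2))
      ((x ^ 3 / 2 : ℝ) * Complex.I))
    have h5 := mul_le_mul hinv h4 (norm_nonneg _) zero_le_one
    have h6 : 0 ≤ |x| ^ 3 := by positivity
    linarith

variable {Ω : Type*} [MeasurableSpace Ω] {P : Measure Ω} [IsProbabilityMeasure P] {Y : ℕ → Ω → ℝ}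
  {Ω' : Type*} [MeasurableSpace Ω'] {P' : Measure Ω'} [IsProbabilityMeasure P'] {Y' : ℕ → Ω' → ℝ}
  {v w : ℕ → ℝ}

theorem IsExpSeq.norm_charFun_weightedSum_sub_le (hY : IsExpSeq P Y) (hY' : IsExpSeq P' Y')
    (hv0 : ∀ i, 0 ≤ v i) (hv : Summable v) (hw0 : ∀ i, 0 ≤ w i) (hw : Summable w) (t : ℝ) :
    ‖charFun (P.map (weightedSum v Y)) t - charFun (P'.map (weightedSum w Y')) t‖
      ≤ |t| * ∑' i, |v i - w i| := by
  have hsum : Summable fun i => |v i - w i| := (hv.sub hw).abs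
  refine le_of_tendsto' ((hY.tendsto_charFun_weightedSum hv0 hv t).sub
    (hY'.tendsto_charFun_weightedSum hw0 hw t)).norm fun N => ?_
  refine (norm_prod_sub_prod_le_sum _ (fun i _ => norm_inv_one_sub_mul_I_le _)
    fun i _ => norm_inv_one_sub_mul_I_le _).trans ?_
  refine (Finset.sum_le_sum fun i _ => norm_inv_one_sub_mul_I_sub_le _ _).trans ?_
  simp_rw [← mul_sub, abs_mul, ← Finset.mul_sum]
  exact mul_le_mul_of_nonneg_left (hsum.sum_le_tsum _ fun i _ => abs_nonneg _) (abs_nonneg t)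

/-- Since the squared weights sum to 1, the Gaussian factor splits as the product of `exp (-(t w i)²
/ 2)`, which is compared factor by factor with the centred exponentials. -/
theorem IsExpSeq.norm_charFun_centered_sub_le (hY : IsExpSeq P Y)
    (hw0 : ∀ i, 0 ≤ w i) (hw : Summable w) (hw2 : HasSum (fun i => w i ^ 2) 1)
    (hw3 : Summable fun i => w i ^ 3) (t : ℝ) :
    ‖charFun (P.map fun ω => weightedSum w Y ω - ∑' i, w i) t - charFun (gaussianReal 0 1) t‖
      ≤ 2 * |t| ^ 3 * ∑' i, w i ^ 3 := by
  have hS := hY.aemeasurable_weightedSum hw0 hw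
  have hchar : charFun (P.map fun ω => weightedSum w Y ω - ∑' i, w i) t
      = Complex.exp (-((t * ∑' i, w i : ℝ) * Complex.I)) *
        charFun (P.map (weightedSum w Y)) t := by
    have : (P.map fun ω => weightedSum w Y ω - ∑' i, w i)
        = (P.map (weightedSum w Y)).map (fun x => x + -∑' i, w i) := by
      rw [AEMeasurable.map_map_of_aemeasurable (by fun_prop) hS]
      rfl
    rw [this, charFun_map_add_const, mul_comm]
    congr 2
    simp [mul_comm]
  have hlim1 : Tendsto (fun N => ∏ i ∈ Finset.range N,
      (Complex.exp (-((t * w i : ℝ) * Complex.I)) * (1 - (t * w i : ℝ) * Complex.I)⁻¹)) atTop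
      (𝓝 (charFun (P.map fun ω => weightedSum w Y ω - ∑' i, w i) t)) := by
    rw [hchar]
    simp_rw [Finset.prod_mul_distrib]
    refine Tendsto.mul ?_ (hY.tendsto_charFun_weightedSum hw0 hw t)
    have hc : Continuous fun x : ℝ => Complex.exp (-((t * x : ℝ) * Complex.I)) := by fun_prop
    refine ((hc.tendsto _).comp hw.hasSum.tendsto_sum_nat).congr fun N => ?_
    rw [Function.comp_apply, ← Complex.exp_sum, Finset.sum_neg_distrib, ← Finset.sum_mul,
      Finset.mul_sum, Complex.ofReal_sum]
  have hlim2 : Tendsto (fun N => ∏ i ∈ Finset.range N, Complex.exp (-((t * w i) ^ 2 / 2 : ℝ)))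
      atTop (𝓝 (charFun (gaussianReal 0 1) t)) := by
    have hc : Continuous fun x : ℝ => Complex.exp (-(t ^ 2 * x / 2 : ℝ)) := by fun_prop
    have h := (hc.tendsto _).comp hw2.tendsto_sum_nat
    have hg : charFun (gaussianReal 0 1) t = Complex.exp (-(t ^ 2 * 1 / 2 : ℝ)) := by
      rw [charFun_gaussianReal]
      congr 1
      push_cast
      simp
    rw [hg]
    refine h.congr fun N => ?_
    rw [Function.comp_apply, ← Complex.exp_sum, Finset.sum_neg_distrib, ← Complex.ofReal_sum,
      Finset.mul_sum, Finset.sum_div]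
    simp_rw [mul_pow]
  refine le_of_tendsto' (hlim1.sub hlim2).norm fun N => ?_
  refine (norm_prod_sub_prod_le_sum _ (fun i _ => ?_) fun i _ => ?_).trans ?_
  · rw [norm_mul, ← neg_mul, ← Complex.ofReal_neg, Complex.norm_exp_ofReal_mul_I, one_mul]
    exact norm_inv_one_sub_mul_I_le _
  · rw [← Complex.ofReal_neg, Complex.norm_exp_ofReal, Real.exp_le_one_iff]
    nlinarith [sq_nonneg (t * w i)]
  · refine (Finset.sum_le_sum fun i _ => norm_exp_mul_inv_sub_exp_le (t * w i)).trans ?_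
    simp_rw [abs_mul, mul_pow, abs_of_nonneg (hw0 _), ← mul_assoc, ← Finset.mul_sum]
    exact mul_le_mul_of_nonneg_left (hw3.sum_le_tsum _ fun i _ => pow_nonneg (hw0 i) 3)
      (by positivity)

/-- Convergence of characteristic functions implies convergence of distribution functions at
continuity points. -/
theorem tendsto_measureReal_Iic_of_tendsto_charFun {μ : ℕ → Measure ℝ} {ν : Measure ℝ}
    [∀ n, IsProbabilityMeasure (μ n)] [IsProbabilityMeasure ν]
    (h : ∀ t, Tendsto (fun n => charFun (μ n) t) atTop (𝓝 (charFun ν t))) {x : ℝ}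
    (hx : ν {x} = 0) : Tendsto (fun n => (μ n).real (Set.Iic x)) atTop (𝓝 (cdf ν x)) := by
  have hweak := ProbabilityMeasure.tendsto_of_tendsto_charFun
    (μ := fun n => (⟨μ n, inferInstance⟩ : ProbabilityMeasure ℝ)) (μ₀ := ⟨ν, inferInstance⟩) h
  have hIic := ProbabilityMeasure.tendsto_measure_of_null_frontier_of_tendsto' hweak
    (E := Set.Iic x) (by rw [frontier_Iic]; exact hx)
  rw [cdf_eq_real]
  exact (ENNReal.tendsto_toReal (measure_ne_top _ _)).comp hIic

end CharFun

/-! ### ℓ¹ convergence of the normalised weights. -/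

section Ratio

variable {a : ℕ → ℝ} {α : ℝ}

theorem tendsto_ratio_pow (h0 : ∀ i, 0 < a i)
    (hratio : Tendsto (fun n => a (n + 1) / a n) atTop (𝓝 α)) (i : ℕ) :
    Tendsto (fun n => a (n + i) / a n) atTop (𝓝 (α ^ i)) := by
  induction i with
  | zero => simp [div_self (h0 _).ne']
  | succ i ih =>
    rw [pow_succ']
    refine ((hratio.comp (tendsto_add_atTop_nat i)).mul ih).congr fun n => ?_
    rw [Function.comp_apply, div_mul_div_cancel₀ (h0 _).ne', add_assoc]

theorem eventually_ratio_le_pow (h0 : ∀ i, 0 < a i)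
    (hratio : Tendsto (fun n => a (n + 1) / a n) atTop (𝓝 α)) {β : ℝ} (hβ : α < β) (hβ0 : 0 ≤ β) :
    ∀ᶠ n in atTop, ∀ i, a (n + i) / a n ≤ β ^ i := by
  obtain ⟨N, hN⟩ := eventually_atTop.1 (hratio.eventually (eventually_le_nhds hβ))
  refine eventually_atTop.2 ⟨N, fun n hn i => ?_⟩
  induction i with
  | zero => simp [div_self (h0 _).ne']
  | succ i ih =>
    have h := mul_le_mul (hN (n + i) (by omega)) ih (div_pos (h0 _) (h0 _)).le hβ0
    rwa [div_mul_div_cancel₀ (h0 _).ne', ← pow_succ'] at h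

/-- The weights `α ^ i * (1 - α)` of the limit variable. -/
noncomputable def limitWeight (α : ℝ) (i : ℕ) : ℝ := α ^ i * (1 - α)

theorem limitWeight_nonneg (hα0 : 0 ≤ α) (hα1 : α < 1) (i : ℕ) : 0 ≤ limitWeight α i :=
  mul_nonneg (pow_nonneg hα0 i) (sub_nonneg.2 hα1.le)

theorem summable_limitWeight (hα0 : 0 ≤ α) (hα1 : α < 1) : Summable (limitWeight α) :=
  (summable_geometric_of_lt_one hα0 hα1).mul_right _

/-- Dominated convergence twice, with `α < β < 1`: first `tailSum a n / a n → 1 / (1 - α)`, then the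
ℓ¹ distance. Since `a n ≤ tailSum a n`, the normalised weights are eventually bounded by `β ^ i`. -/
theorem tendsto_tsum_abs_sub_limitWeight (h0 : ∀ i, 0 < a i) (ha : Summable a) (hα0 : 0 ≤ α)
    (hα1 : α < 1) (hratio : Tendsto (fun n => a (n + 1) / a n) atTop (𝓝 α)) :
    Tendsto (fun n => ∑' i, |a (n + i) / tailSum a n - limitWeight α i|) atTop (𝓝 0) := by
  obtain ⟨β, hαβ, hβ1⟩ := exists_between hα1
  have hβ0 : 0 ≤ β := hα0.trans hαβ.le
  have hgeo := summable_geometric_of_lt_one hβ0 hβ1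
  have hle := eventually_ratio_le_pow h0 hratio hαβ hβ0
  have htail : Tendsto (fun n => tailSum a n / a n) atTop (𝓝 (1 - α)⁻¹) := by
    rw [← tsum_geometric_of_lt_one hα0 hα1]
    simp_rw [tailSum, ← tsum_div_const]
    refine tendsto_tsum_of_dominated_convergence hgeo (tendsto_ratio_pow h0 hratio) ?_
    filter_upwards [hle] with n hn i
    rw [Real.norm_of_nonneg (div_pos (h0 _) (h0 _)).le]
    exact hn i
  have hpos := tailSum_pos h0 ha
  have hlim : ∀ i, Tendsto (fun n => |a (n + i) / tailSum a n - limitWeight α i|) atTop (𝓝 0) := by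
    intro i
    have h := (tendsto_ratio_pow h0 hratio i).mul (htail.inv₀ (inv_pos.2 (sub_pos.2 hα1)).ne')
    rw [inv_inv] at h
    have h' := (h.sub_const (limitWeight α i)).abs
    rw [limitWeight, sub_self, abs_zero] at h'
    refine h'.congr fun n => ?_
    rw [inv_div, div_mul_div_cancel₀ (h0 n).ne', limitWeight]
  have hdom := tendsto_tsum_of_dominated_convergence (hgeo.add (summable_limitWeight hα0 hα1)) hlim
    (by
      filter_upwards [hle] with n hn i
      have hw := limitWeight_nonneg hα0 hα1 i
      have hq : 0 ≤ a (n + i) / tailSum a n := (div_pos (h0 _) (hpos n)).le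
      have hq' : a (n + i) / tailSum a n ≤ β ^ i := by
        refine le_trans ?_ (hn i)
        refine div_le_div_of_nonneg_left (h0 _).le (h0 n) ?_
        rw [tailSum_eq_add ha]
        exact le_add_of_nonneg_right (hpos _).le
      rw [norm_abs_eq_norm]
      refine (norm_sub_le _ _).trans ?_
      rw [Real.norm_of_nonneg hq, Real.norm_of_nonneg hw]
      exact add_le_add_left hq' _)
  simpa using hdom

end Ratio

/-! ### Limit theorems for normalised weighted sums. -/

section Limits

variable {Ω : Type*} [MeasurableSpace Ω] {P : Measure Ω} [IsProbabilityMeasure P] {Y : ℕ → Ω → ℝ}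
  {Ω' : Type*} [MeasurableSpace Ω'] {P' : Measure Ω'} [IsProbabilityMeasure P'] {Y' : ℕ → Ω' → ℝ}
  {a : ℕ → ℝ} {α : ℝ}

theorem weightedSum_div {Ω : Type*} (w : ℕ → ℝ) (Y : ℕ → Ω → ℝ) (c : ℝ) (ω : Ω) :
    weightedSum w Y ω / c = weightedSum (fun i => w i / c) Y ω := by
  rw [weightedSum, weightedSum, ← tsum_div_const]
  simp_rw [div_mul_eq_mul_div]

theorem measureReal_le_eq_map {Ω : Type*} [MeasurableSpace Ω] {P : Measure Ω} {f : Ω → ℝ} (hf : AEMeasurable f P) (x : ℝ) :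
    P.real {ω | f ω ≤ x} = (P.map f).real (Set.Iic x) := by
  rw [measureReal_def, measureReal_def, Measure.map_apply_of_aemeasurable hf measurableSet_Iic]
  rfl

theorem IsExpSeq.isLimitLaw (hY : IsExpSeq P Y) (hα0 : 0 ≤ α) (hα1 : α < 1) :
    IsLimitLaw α (P.map (weightedSum (limitWeight α) Y)) where
  isProbabilityMeasure := hY.isProbabilityMeasure_map (limitWeight_nonneg hα0 hα1)
    (summable_limitWeight hα0 hα1)
  nonneg := by
    have hw0 := limitWeight_nonneg hα0 hα1
    rw [Measure.map_apply_of_aemeasurable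
      (hY.aemeasurable_weightedSum hw0 (summable_limitWeight hα0 hα1)) measurableSet_Iio]
    refine measure_mono_null (fun ω hω => ?_) (ae_iff.1 (hY.ae_weightedSum_nonneg hw0))
    simpa using hω
  laplace u hu := by
    have h := hY.hasProd_laplace_weightedSum (limitWeight_nonneg hα0 hα1)
      (summable_limitWeight hα0 hα1) hu
    simpa only [limitWeight, one_div, mul_assoc] using h

theorem IsExpSeq.tendsto_cdf_weightedSum_div_tailSum (hY : IsExpSeq P Y) (hY' : IsExpSeq P' Y')
    (h0 : ∀ i, 0 < a i) (ha : Summable a) (hα0 : 0 ≤ α) (hα1 : α < 1)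
    (hratio : Tendsto (fun n => a (n + 1) / a n) atTop (𝓝 α)) (x : ℝ) :
    Tendsto (fun n => P.real {ω | weightedSum (fun i => a (n + i)) (fun i => Y (n + i)) ω
      / tailSum a n ≤ x}) atTop (𝓝 (cdf (P'.map (weightedSum (limitWeight α) Y')) x)) := by
  have hpos := tailSum_pos h0 ha
  have hv0 : ∀ n i, 0 ≤ a (n + i) / tailSum a n := fun n i => (div_pos (h0 _) (hpos n)).le
  have hv : ∀ n, Summable fun i => a (n + i) / tailSum a n :=
    fun n => (summable_tail ha n).div_const _
  have hw0 := limitWeight_nonneg hα0 hα1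
  have hw := summable_limitWeight hα0 hα1
  have := hY'.isProbabilityMeasure_map hw0 hw
  have := fun n => (hY.shift n).isProbabilityMeasure_map (hv0 n) (hv n)
  simp_rw [weightedSum_div,
    measureReal_le_eq_map ((hY.shift _).aemeasurable_weightedSum (hv0 _) (hv _))]
  refine tendsto_measureReal_Iic_of_tendsto_charFun (fun t => ?_)
    (hY'.map_weightedSum_singleton hw0 hw (by simpa [limitWeight] using hα1) x)
  rw [tendsto_iff_norm_sub_tendsto_zero]
  have hlim := (tendsto_tsum_abs_sub_limitWeight h0 ha hα0 hα1 hratio).const_mul |t|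
  rw [mul_zero] at hlim
  exact squeeze_zero (fun n => norm_nonneg _)
    (fun n => (hY.shift n).norm_charFun_weightedSum_sub_le hY' (hv0 n) (hv n) hw0 hw t) hlim

theorem IsExpSeq.tendsto_cdf_gaussian (hY : IsExpSeq P Y) (h0 : ∀ i, 0 < a i) (ha : Summable a)
    (hCB : (fun n => (∑' i, a (n + i) ^ 3) ^ (1 / 3 : ℝ)) =o[atTop]
      fun n => √(∑' i, a (n + i) ^ 2)) (x : ℝ) :
    Tendsto (fun n => P.real {ω | (weightedSum (fun i => a (n + i)) (fun i => Y (n + i)) ω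
      - tailSum a n) / √(∑' i, a (n + i) ^ 2) ≤ x}) atTop (𝓝 (cdf (gaussianReal 0 1) x)) := by
  let b : ℕ → ℝ := fun n => √(∑' i, a (n + i) ^ 2)
  have h2 := summable_pow_of_summable h0 ha two_ne_zero
  have h3 := summable_pow_of_summable h0 ha three_ne_zero
  have hs2 : ∀ n, 0 < ∑' i, a (n + i) ^ 2 := fun n =>
    (summable_tail h2 n).tsum_pos (fun i => sq_nonneg _) 0 (pow_pos (h0 _) 2)
  have hbpos : ∀ n, 0 < b n := fun n => Real.sqrt_pos.2 (hs2 n)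
  have hbsq : ∀ n, b n ^ 2 = ∑' i, a (n + i) ^ 2 := fun n => Real.sq_sqrt (hs2 n).le
  have hv0 : ∀ n i, 0 ≤ a (n + i) / b n := fun n i => (div_pos (h0 _) (hbpos n)).le
  have hv : ∀ n, Summable fun i => a (n + i) / b n := fun n => (summable_tail ha n).div_const _
  have hv2 : ∀ n, HasSum (fun i => (a (n + i) / b n) ^ 2) 1 := by
    intro n
    have h := (summable_tail h2 n).hasSum.div_const (b n ^ 2)
    rw [← hbsq, div_self (pow_pos (hbpos n) 2).ne'] at h
    simpa only [div_pow] using h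
  have hv3 : ∀ n, Summable fun i => (a (n + i) / b n) ^ 3 := by
    intro n
    simpa only [div_pow] using (summable_tail h3 n).div_const (b n ^ 3)
  have hcenter : ∀ n ω, (weightedSum (fun i => a (n + i)) (fun i => Y (n + i)) ω
      - tailSum a n) / √(∑' i, a (n + i) ^ 2) = weightedSum (fun i => a (n + i) / b n) (fun i => Y (n + i)) ω
        - ∑' i, a (n + i) / b n := by
    intro n ω
    change _ / b n = _
    rw [sub_div, weightedSum_div, tailSum, tsum_div_const]
  have hm : ∀ n, AEMeasurable (fun ω => weightedSum (fun i => a (n + i) / b n)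
      (fun i => Y (n + i)) ω - ∑' i, a (n + i) / b n) P :=
    fun n => ((hY.shift n).aemeasurable_weightedSum (hv0 n) (hv n)).sub_const _
  have := fun n => Measure.isProbabilityMeasure_map (hm n)
  simp_rw [hcenter, fun n => measureReal_le_eq_map (hm n) x]
  have hnull : NullSingletonClass (gaussianReal 0 1) := nullSingletonClass_gaussianReal one_ne_zero
  refine tendsto_measureReal_Iic_of_tendsto_charFun (fun t => ?_) (measure_singleton x)
  rw [tendsto_iff_norm_sub_tendsto_zero]
  -- The sum of the cubed normalised weights is the cube of the ratio assumed negligible.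
  have hcube : Tendsto (fun n => ∑' i, (a (n + i) / b n) ^ 3) atTop (𝓝 0) := by
    have h := (hCB.tendsto_div_nhds_zero).pow 3
    rw [zero_pow three_ne_zero] at h
    refine h.congr fun n => ?_
    have hnn : 0 ≤ ∑' i, a (n + i) ^ 3 := tsum_nonneg fun i => pow_nonneg (h0 _).le 3
    simp_rw [div_pow]
    rw [tsum_div_const, ← Real.rpow_natCast (_ ^ (1 / 3 : ℝ)), ← Real.rpow_mul hnn]
    norm_num [b]
  have hlim := hcube.const_mul (2 * |t| ^ 3)
  rw [mul_zero] at hlim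
  exact squeeze_zero (fun n => norm_nonneg _)
    (fun n => (hY.shift n).norm_charFun_centered_sub_le (hv0 n) (hv n) (hv2 n) (hv3 n) t) hlim

end Limits

/-! ### Translation from holding times to weighted sums. -/

section HoldingTimes

variable {Ω : Type*} [MeasurableSpace Ω] {P : Measure Ω} {lam : ℕ → ℝ} {X : ℕ → Ω → ℝ}

theorem IsHoldingTimes.isExpSeq (hX : IsHoldingTimes P lam X) :
    IsExpSeq P (fun k ω => lam (k + 2) * X (k + 2) ω) where
  hasLaw k := by
    have hpos := hX.rate_pos (k + 2) (by omega)
    have hlaw := hX.hasLaw (k + 2) (by omega)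
    refine ⟨hlaw.aemeasurable.const_mul _, ?_⟩
    rw [← map_mul_expMeasure hpos, ← hlaw.map_eq,
      AEMeasurable.map_map_of_aemeasurable (by fun_prop) hlaw.aemeasurable]
    rfl
  indep := by
    have hinj : Function.Injective fun k : ℕ => (⟨k + 2, by omega⟩ : {i : ℕ // 2 ≤ i}) :=
      fun j k h => by simpa using h
    exact (hX.indep.precomp hinj).comp (fun k x => lam (k + 2) * x) fun k => by fun_prop

theorem IsHoldingTimes.inv_mul_mul (hX : IsHoldingTimes P lam X) (k : ℕ) (ω : Ω) :
    (lam (k + 2))⁻¹ * (lam (k + 2) * X (k + 2) ω) = X (k + 2) ω :=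
  inv_mul_cancel_left₀ (hX.rate_pos (k + 2) (by omega)).ne' _

theorem IsHoldingTimes.T_succ (hX : IsHoldingTimes P lam X) (m : ℕ) :
    T X (m + 1) = weightedSum (fun i => (lam (m + i + 2))⁻¹)
      (fun i ω => lam (m + i + 2) * X (m + i + 2) ω) := by
  ext ω
  rw [T, weightedSum]
  refine tsum_congr fun i => ?_
  rw [hX.inv_mul_mul, show m + 1 + 1 + i = m + i + 2 by omega]

theorem A_succ (lam : ℕ → ℝ) (m : ℕ) :
    A lam (m + 1) = tailSum (fun k => (lam (k + 2))⁻¹) m :=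
  tsum_congr fun i => by rw [show m + 1 + 1 + i = m + i + 2 by omega]

theorem B_succ (lam : ℕ → ℝ) (m : ℕ) :
    B lam (m + 1) = √(∑' i, (lam (m + i + 2))⁻¹ ^ 2) := by
  rw [B]
  congr 1
  exact tsum_congr fun i => by rw [show m + 1 + 1 + i = m + i + 2 by omega, inv_pow]

theorem C_succ (lam : ℕ → ℝ) (m : ℕ) :
    C lam (m + 1) = (∑' i, (lam (m + i + 2))⁻¹ ^ 3) ^ (1 / 3 : ℝ) := by
  rw [C]
  congr 1
  exact tsum_congr fun i => by rw [show m + 1 + 1 + i = m + i + 2 by omega, inv_pow]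

/-- An index mismatch: `A lam (k+2)` is the tail after the term `k`, whereas the target tail
includes that term and is therefore larger. -/
theorem isLittleO_tailSum (hpos : ∀ k, 0 < (lam (k + 2))⁻¹)
    (hsum : Summable fun k => (lam (k + 2))⁻¹)
    (h : (fun n => (lam n)⁻¹) =o[atTop] A lam) :
    (fun k => (lam (k + 2))⁻¹) =o[atTop] tailSum fun k => (lam (k + 2))⁻¹ := by
  refine (h.comp_tendsto (tendsto_add_atTop_nat 2)).trans_isBigO (IsBigO.of_bound 1 ?_)
  refine Eventually.of_forall fun k => ?_
  rw [Function.comp_apply, A_succ lam (k + 1), Real.norm_of_nonneg (tailSum_pos hpos hsum _).le,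
    Real.norm_of_nonneg (tailSum_pos hpos hsum _).le, one_mul]
  exact antitone_tailSum hpos hsum k.le_succ

end HoldingTimes

end PureDeath

/-! ### Assembly of the statements. -/

theorem theorem1 :
    ∃ F : ℝ → Measure ℝ,
      (∀ α : ℝ, 0 ≤ α → α < 1 → PureDeath.IsLimitLaw α (F α)) ∧
      ∀ (Ω : Type*) [MeasurableSpace Ω] (P : Measure Ω) [IsProbabilityMeasure P]
        (lam : ℕ → ℝ) (X : ℕ → Ω → ℝ),
        PureDeath.IsHoldingTimes P lam X →
        Summable (fun n : ℕ => (lam (n + 2))⁻¹) →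
        -- the series `T n` converges a.s., with mean `A n` and variance `(B n) ^ 2`
        (∀ n : ℕ, 1 ≤ n →
          (∀ᵐ ω ∂P, Summable (fun i : ℕ => X (n + 1 + i) ω)) ∧
          MemLp (PureDeath.T X n) 2 P ∧
          (∫ ω, PureDeath.T X n ω ∂P) = PureDeath.A lam n ∧
          variance (PureDeath.T X n) P = (PureDeath.B lam n) ^ 2) ∧
        -- (i)
        (∀ α : ℝ, 0 ≤ α → α < 1 →
          Tendsto (fun n : ℕ => lam n / lam (n + 1)) atTop (𝓝 α) →
          ∀ x : ℝ, 0 ≤ x →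
            Tendsto (fun n : ℕ => P.real {ω | PureDeath.T X n ω / PureDeath.A lam n ≤ x})
              atTop (𝓝 (cdf (F α) x))) ∧
        -- (ii)
        ((fun n : ℕ => (lam n)⁻¹) =o[atTop] PureDeath.A lam →
          TendstoInMeasure P (fun (n : ℕ) ω => PureDeath.T X n ω / PureDeath.A lam n)
            atTop (fun _ => (1 : ℝ))) ∧
        -- (iii)
        (Summable (fun i : ℕ => ((lam (i + 2) * PureDeath.A lam (i + 1)) ^ 2)⁻¹) →
          ∀ᵐ ω ∂P, Tendsto (fun n : ℕ => PureDeath.T X n ω / PureDeath.A lam n)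
            atTop (𝓝 1)) ∧
        -- (iv)
        ((fun n : ℕ => (lam n)⁻¹) =o[atTop] PureDeath.A lam →
          PureDeath.C lam =o[atTop] PureDeath.B lam →
          ∀ x : ℝ,
            Tendsto (fun n : ℕ =>
                P.real {ω | (PureDeath.T X n ω - PureDeath.A lam n) / PureDeath.B lam n ≤ x})
              atTop (𝓝 (cdf (gaussianReal 0 1) x))) := by
  have := isProbabilityMeasure_expMeasure one_pos
  -- An auxiliary i.i.d. sequence, chosen before the process, makes the limit law depend on `α`
  -- alone.
  obtain ⟨Ω₀, _, P₀, Y₀, -, hlaw₀, hindep₀, _⟩ := exists_iid ℕ (expMeasure 1)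
  have hY₀ : PureDeath.IsExpSeq P₀ Y₀ := ⟨hlaw₀, hindep₀⟩
  refine ⟨fun α => P₀.map (PureDeath.weightedSum (PureDeath.limitWeight α) Y₀),
    fun α hα0 hα1 => hY₀.isLimitLaw hα0 hα1, ?_⟩
  intro Ω _ P _ lam X hX hsum
  have hY := hX.isExpSeq
  have hpos : ∀ k, 0 < (lam (k + 2))⁻¹ := fun k => inv_pos.2 (hX.rate_pos _ (by omega))
  refine ⟨fun n hn => ?_, fun α hα0 hα1 hratio x _ => ?_, fun hsmall ε hε => ?_,
    fun hsq => ?_, fun _ hCB x => ?_⟩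
  · obtain ⟨m, rfl⟩ := Nat.exists_eq_add_of_le' hn
    have hw0 : ∀ i, 0 ≤ (lam (m + i + 2))⁻¹ := fun i => (hpos _).le
    have hw := PureDeath.summable_tail hsum m
    have hw2 := PureDeath.summable_tail
      (PureDeath.summable_pow_of_summable hpos hsum two_ne_zero) m
    rw [hX.T_succ, PureDeath.A_succ, PureDeath.B_succ,
      Real.sq_sqrt (tsum_nonneg fun i => sq_nonneg _)]
    refine ⟨?_, (hY.shift m).memLp_weightedSum hw0 hw hw2,
      (hY.shift m).integral_weightedSum hw0 hw, (hY.shift m).variance_weightedSum hw0 hw hw2⟩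
    filter_upwards [(hY.shift m).ae_summable hw0 hw] with ω h
    refine h.congr fun i => ?_
    rw [hX.inv_mul_mul, show m + 1 + 1 + i = m + i + 2 by omega]
  -- Dropping `n = 0` is essential: `T X 0` and `A lam 0` involve index 1, which carries no
  -- condition.
  · rw [← tendsto_add_atTop_iff_nat 1]
    simp_rw [hX.T_succ, PureDeath.A_succ]
    refine hY.tendsto_cdf_weightedSum_div_tailSum hY₀ hpos hsum hα0 hα1 ?_ x
    refine (hratio.comp (tendsto_add_atTop_nat 2)).congr fun n => ?_
    rw [Function.comp_apply, inv_div_inv, show n + 1 + 2 = n + 2 + 1 by omega]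
  · rw [← tendsto_add_atTop_iff_nat 1]
    simp_rw [hX.T_succ, PureDeath.A_succ]
    exact hY.tendstoInMeasure_weightedSum_div_tailSum hpos hsum
      (PureDeath.isLittleO_tailSum hpos hsum hsmall) ε hε
  -- Here `1 / (lam (i+2) * A lam (i+1))` is exactly `a i / tailSum a i`.
  · have h := hY.ae_tendsto_weightedSum_div_tailSum hpos hsum (hsq.congr fun i => by
      rw [PureDeath.A_succ, div_eq_mul_inv, ← mul_inv, inv_pow])
    filter_upwards [h] with ω hω
    rw [← tendsto_add_atTop_iff_nat 1]
    simp_rw [hX.T_succ, PureDeath.A_succ]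
    exact hω
  · rw [← tendsto_add_atTop_iff_nat 1]
    simp_rw [hX.T_succ, PureDeath.A_succ, PureDeath.B_succ]
    refine hY.tendsto_cdf_gaussian hpos hsum ?_ x
    have h := hCB.comp_tendsto (tendsto_add_atTop_nat 1)
    refine (h.congr (fun n => ?_) fun n => ?_)
    · rw [Function.comp_apply, PureDeath.C_succ]
    · rw [Function.comp_apply, PureDeath.B_succ]
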